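/- Fix an integer $n\ge 1$. All values are non-negative, and all distributions on $[0,\infty)$ below have finite mean. For i.i.d. values $X_1,\dots,X_n\sim F$ let $X_{(1)}\le\dots\le X_{(n)}$ be the order statistics. The distribution $F$ is known to the decision-maker, and policies are sequential: the decision in a period depends only on the values observed up to and including that period. *The $(k,n)$-selection problem* ($1\le k\le n$). The values are drawn i.i.d. from a continuous (atomless) distribution $F$ and shown one after the other; each is irrevocably selected or rejected when it is shown, and at most $k$ values are selected. The value of a policy is the expected sum of the selected values, and the offline optimum is $\mathrm{OPT}_{n,k}(F)=\mathbb{E}\big[\sum_{i=n-k+1}^n X_{(i)}\big]$. Let $\gamma_{n,k}$ be the optimal approximation ratio, i.e. the supremum of all $c$ such that, for every such $F$, some policy has value at least $c\cdot \mathrm{OPT}_{n,k}(F)$. *The i.i.d. sequential stochastic assignment problem with $n$ periods.* The input consists of rewards $0\le r_1\le\dots\le r_n$ and a distribution $F$ on $[0,\infty)$ (not necessarily continuous). The values are drawn i.i.d. from $F$ and shown one after the other; each is irrevocably assigned, when it is shown, to one of the rewards not yet used, so that in the end each reward is used exactly once. If $\pi(t)$ denotes the index of the reward assigned to the value $X_t$,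 the value of a policy $\pi$ is $v_{n,F,r}(\pi)=\mathbb{E}\big[\sum_{t=1}^n X_t\, r_{\pi(t)}\big]$, and the offline optimum is $\sum_{t=1}^n r_t\,\mathbb{E}[X_{(t)}]$. Let $\alpha_n$ be the optimal approximation ratio, i.e. the supremum of all $c$ such that, for every such $F$ and $r$, some policy has value at least $c\sum_{t=1}^n r_t\,\mathbb{E}[X_{(t)}]$. Then, for every $n\ge 1$, $$\alpha_n\ \ge\ \min_{1\le k\le n}\gamma_{n,k}.$$ -/

import Mathlib

open MeasureTheory

noncomputable section

namespace SSAP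

/-- A probability distribution of non-negative values with finite mean. -/
structure IsValueDist (F : Measure ℝ) : Prop where
  isProbability : IsProbabilityMeasure F
  nonneg : F (Set.Iio 0) = 0
  finite_mean : Integrable id F

/-- The joint law of `n` independent values with common distribution `F`. The coordinate `x t` of
`x : Fin n → ℝ` is the value shown in period `t`; periods run through `0, 1, …, n - 1`. -/
def sampleLaw (n : ℕ) (F : Measure ℝ) : Measure (Fin n → ℝ) :=
  Measure.pi fun _ => F

/-- The order statistics of a sample, in increasing order:
`orderStat x 0 ≤ orderStat x 1 ≤ … ≤ orderStat x (n - 1)`. -/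
def orderStat {n : ℕ} (x : Fin n → ℝ) (i : Fin n) : ℝ :=
  x (Tuple.sort x i)

/-! ### The `k`-selection problem with `n` i.i.d. values -/

/-- A sequential policy that selects at most `k` of `n` values: whether the value of period `t` is
selected depends, measurably, on the values shown up to period `t` only. -/
structure SelectionPolicy (n k : ℕ) where
  /-- the set of periods whose values are selected when the sample is `x` -/
  select : (Fin n → ℝ) → Finset (Fin n)
  measurableSet_select : ∀ t, MeasurableSet {x | t ∈ select x}
  nonanticipating : ∀ (t : Fin n) (x y : Fin n → ℝ), (∀ s ≤ t, x s = y s) →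
    (t ∈ select x ↔ t ∈ select y)
  card_select_le : ∀ x, (select x).card ≤ k

/-- The expected sum of the values selected by a policy. -/
def SelectionPolicy.value {n k : ℕ} (A : SelectionPolicy n k) (F : Measure ℝ) : ℝ :=
  ∫ x, ∑ t ∈ A.select x, x t ∂(sampleLaw n F)

/-- The offline optimum of the `k`-selection problem: the expected sum of the `k` largest
among `n` values. -/
def selectionOpt (n k : ℕ) (F : Measure ℝ) : ℝ :=
  ∫ x, ∑ i ∈ Finset.univ.filter (fun i : Fin n => n ≤ (i : ℕ) + k),
    orderStat x i ∂(sampleLaw n F)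

/-- `c` is an approximation ratio attained by some algorithm for the `k`-selection problem with `n`
values. The distribution is an input of the algorithm, and is continuous (it has no atoms). -/
def IsSelectionRatio (n k : ℕ) (c : ℝ) : Prop :=
  ∃ alg : Measure ℝ → SelectionPolicy n k,
    ∀ F : Measure ℝ, IsValueDist F → NullSingletonClass F → c * selectionOpt n k F ≤ (alg F).value F

/-- The optimal approximation ratio of the `k`-selection problem with `n` values. -/
def gamma (n k : ℕ) : ℝ :=
  sSup {c : ℝ | IsSelectionRatio n k c}

/-! ### The sequential stochastic assignment problem with `n` i.i.d. values -/

/-- A sequential assignment policy: `assign x t` is the index of the reward to which the value of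
period `t` is assigned when the sample is `x`. Each reward is used exactly once, and the assignment
made in period `t` depends, measurably, on the values shown up to period `t` only. -/
structure AssignmentPolicy (n : ℕ) where
  assign : (Fin n → ℝ) → Equiv.Perm (Fin n)
  measurableSet_assign : ∀ t i, MeasurableSet {x | assign x t = i}
  nonanticipating : ∀ (t : Fin n) (x y : Fin n → ℝ), (∀ s ≤ t, x s = y s) →
    assign x t = assign y t

/-- The expected total reward of an assignment policy with rewards `r`. -/
def AssignmentPolicy.value {n : ℕ} (π : AssignmentPolicy n) (F : Measure ℝ) (r : Fin n → ℝ) : ℝ :=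
  ∫ x, ∑ t, x t * r (π.assign x t) ∂(sampleLaw n F)

/-- The offline optimum of the assignment problem. -/
def assignmentOpt (n : ℕ) (F : Measure ℝ) (r : Fin n → ℝ) : ℝ :=
  ∑ i, r i * ∫ x, orderStat x i ∂(sampleLaw n F)

/-- `c` is an approximation ratio attained by some algorithm for the assignment problem with `n`
periods. The distribution and the non-decreasing non-negative rewards are inputs of the
algorithm. -/
def IsAssignmentRatio (n : ℕ) (c : ℝ) : Prop :=
  ∃ alg : Measure ℝ → (Fin n → ℝ) → AssignmentPolicy n,
    ∀ (F : Measure ℝ) (r : Fin n → ℝ), IsValueDist F → Monotone r → (∀ i, 0 ≤ r i) →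
      c * assignmentOpt n F r ≤ (alg F r).value F r

/-- The optimal approximation ratio of the assignment problem with `n` periods. -/
def alpha (n : ℕ) : ℝ :=
  sSup {c : ℝ | IsAssignmentRatio n c}

end SSAP

end

noncomputable section
namespace SSAP

/-! ### Marginal values of the remaining rewards -/

/-! Both problems are governed by one sequence of numbers. In the assignment problem an optimal
policy (Derman–Lieberman–Ross) needs only the ranking of the rewards: the current value takes the
reward whose rank is its position among the `marginal` values of the next period. Its value is
therefore linear in the rewards, with coefficients `marginal F n k` (`rankPolicy_value`). For k unit
rewards the coefficients sum to `selectionValue F n k`, which bounds every k-selection policy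
(`SelectionPolicy.value_le`).

The offline optimum is linear in the rewards too, and its partial sums from the top are
`selectionOpt`. Monotone non-negative rewards are non-negative combinations of such 0/1 rewards, so
a ratio c valid for every k carries over to them by summation by parts (`mul_assignmentOpt_le`).

The selection ratios concern only atomless F. A general F is replaced by the law of X + εU: the
offline optimum does not drop, `selectionValue` grows by at most kε, and ε tends to 0
(`IsSelectionRatio.mul_selectionOpt_le`). -/

/-- The result of inserting `x` into a non-increasing sequence, keeping it non-increasing. -/
def insertDesc (x : ℝ) (a : ℕ → ℝ) : ℕ → ℝ
  | 0 => max x (a 0)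
  | k + 1 => max (min x (a k)) (a (k + 1))

/-- The expected value assigned, with `n` periods to go, to the reward of rank `k`
(`k = 0` being the largest reward) by the optimal policy. -/
def marginal (F : Measure ℝ) : ℕ → ℕ → ℝ
  | 0, _ => 0
  | n + 1, k => ∫ x, insertDesc x (marginal F n) k ∂F

/-- The optimal value of the `k`-selection problem with `n` periods. -/
def selectionValue (F : Measure ℝ) (n k : ℕ) : ℝ :=
  ∑ j ∈ Finset.range k, marginal F n j

lemma antitone_insertDesc (x : ℝ) {a : ℕ → ℝ} (ha : Antitone a) : Antitone (insertDesc x a) := by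
  refine antitone_nat_of_succ_le fun k => ?_
  have h1 : a (k + 1) ≤ a k := ha k.le_succ
  cases k with
  | zero => simp only [insertDesc]; grind
  | succ k => simp only [insertDesc]; grind

/-- The k + 1 largest of x, a 0, …, a k omit only the smaller of x and a k. Integrated over x, this
is the Bellman equation of `selectionValue`. -/
lemma sum_insertDesc (x : ℝ) {a : ℕ → ℝ} (ha : Antitone a) (k : ℕ) :
    ∑ j ∈ Finset.range (k + 1), insertDesc x a j = max x (a k) + ∑ j ∈ Finset.range k, a j := by
  induction k with
  | zero => simp [insertDesc]
  | succ k ih =>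
    rw [Finset.sum_range_succ, ih, Finset.sum_range_succ a]
    have h1 : a (k + 1) ≤ a k := ha k.le_succ
    simp only [insertDesc]
    grind

variable {F : Measure ℝ}

lemma integrable_insertDesc [IsFiniteMeasure F] (hF : Integrable id F) (a : ℕ → ℝ) (k : ℕ) :
    Integrable (fun x => insertDesc x a k) F := by
  cases k with
  | zero => exact hF.sup (integrable_const (a 0))
  | succ k => exact (hF.inf (integrable_const (a k))).sup (integrable_const (a (k + 1)))

lemma antitone_marginal [IsFiniteMeasure F] (hF : Integrable id F) (n : ℕ) :
    Antitone (marginal F n) := by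
  induction n with
  | zero => exact fun _ _ _ => le_rfl
  | succ n ih =>
    exact fun i j hij => integral_mono (integrable_insertDesc hF _ _)
      (integrable_insertDesc hF _ _) fun x => antitone_insertDesc x ih hij

lemma IsValueDist.ae_nonneg (h : IsValueDist F) : ∀ᵐ x ∂F, 0 ≤ x := by
  simpa [ae_iff, not_le, Set.Iio] using h.nonneg

lemma IsValueDist.marginal_eq_zero (h : IsValueDist F) {n k : ℕ} (hk : n ≤ k) :
    marginal F n k = 0 := by
  induction n generalizing k with
  | zero => rfl
  | succ n ih =>
    obtain ⟨k, rfl⟩ : ∃ l, k = l + 1 := ⟨k - 1, by omega⟩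
    refine integral_eq_zero_of_ae ?_
    filter_upwards [h.ae_nonneg] with x hx
    simp [insertDesc, ih (show n ≤ k by omega), ih (show n ≤ k + 1 by omega), hx]

@[simp] lemma selectionValue_zero_left (k : ℕ) : selectionValue F 0 k = 0 := by
  simp [selectionValue, marginal]

@[simp] lemma selectionValue_zero_right (n : ℕ) : selectionValue F n 0 = 0 := by
  simp [selectionValue]

lemma selectionValue_succ_succ [IsProbabilityMeasure F] (hF : Integrable id F) (n k : ℕ) :
    selectionValue F (n + 1) (k + 1) =
      ∫ x, max (x + selectionValue F n k) (selectionValue F n (k + 1)) ∂F := by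
  simp only [selectionValue, marginal]
  rw [← integral_finsetSum _ fun j _ => integrable_insertDesc hF _ j]
  refine integral_congr_ae (.of_forall fun x => ?_)
  simp only [sum_insertDesc x (antitone_marginal hF n), Finset.sum_range_succ]
  rw [← max_add_add_right, add_comm (marginal F n k)]

/-! ### Conditioning on the first value -/

lemma integral_sampleLaw_succ [IsProbabilityMeasure F] {n : ℕ} {f : (Fin (n + 1) → ℝ) → ℝ}
    (hf : Integrable f (sampleLaw (n + 1) F)) :
    Integrable (fun x₀ => ∫ y, f (Fin.cons x₀ y) ∂sampleLaw n F) F ∧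
      ∫ x, f x ∂sampleLaw (n + 1) F = ∫ x₀, ∫ y, f (Fin.cons x₀ y) ∂sampleLaw n F ∂F := by
  have hmp := (measurePreserving_piFinSuccAbove (fun _ : Fin (n + 1) => F) 0).symm
  have hcons : ∀ p : ℝ × (Fin n → ℝ),
      (MeasurableEquiv.piFinSuccAbove (fun _ : Fin (n + 1) => ℝ) 0).symm p = Fin.cons p.1 p.2 := by
    intro p
    simp [MeasurableEquiv.piFinSuccAbove, Fin.insertNthEquiv]
  have hint : Integrable (fun p : ℝ × (Fin n → ℝ) => f (Fin.cons p.1 p.2))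
      (F.prod (sampleLaw n F)) := by
    have := (hmp.integrable_comp_emb (MeasurableEquiv.measurableEmbedding _)).2 hf
    simp only [Function.comp_def, hcons] at this
    exact this
  have : IsProbabilityMeasure (sampleLaw n F) := by unfold sampleLaw; infer_instance
  refine ⟨hint.integral_prod_left, ?_⟩
  rw [← integral_prod _ hint]
  have := hmp.integral_comp' f
  simp only [hcons] at this
  exact this.symm

lemma integrable_eval_sampleLaw [IsProbabilityMeasure F] (hF : Integrable id F) {n : ℕ}
    (t : Fin n) : Integrable (fun x : Fin n → ℝ => x t) (sampleLaw n F) :=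
  integrable_comp_eval (μ := fun _ : Fin n => F) (f := id) hF

instance [IsProbabilityMeasure F] (n : ℕ) : IsProbabilityMeasure (sampleLaw n F) := by
  unfold sampleLaw; infer_instance

/-! ### No selection policy beats `selectionValue` -/

lemma SelectionPolicy.integrable {n k : ℕ} (A : SelectionPolicy n k) [IsProbabilityMeasure F]
    (hF : Integrable id F) :
    Integrable (fun x => ∑ t ∈ A.select x, x t) (sampleLaw n F) := by
  have : (fun x : Fin n → ℝ => ∑ t ∈ A.select x, x t) =
      fun x => ∑ t, {x | t ∈ A.select x}.indicator (fun x => x t) x := by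
    ext x
    simp [Set.indicator_apply, Finset.sum_ite_mem]
  rw [this]
  exact integrable_finsetSum _ fun t _ =>
    (integrable_eval_sampleLaw hF t).indicator (A.measurableSet_select t)

/-- The policy for the remaining `n` periods after the first value `x₀`. -/
def SelectionPolicy.tail {n k : ℕ} (A : SelectionPolicy (n + 1) k) (x₀ : ℝ) (l : ℕ)
    (hl : ∀ y : Fin n → ℝ,
      (Finset.univ.filter fun t : Fin n => t.succ ∈ A.select (Fin.cons x₀ y)).card ≤ l) :
    SelectionPolicy n l where
  select y := Finset.univ.filter fun t => t.succ ∈ A.select (Fin.cons x₀ y)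
  measurableSet_select t := by
    have hm : Measurable fun y : Fin n → ℝ => (Fin.cons x₀ y : Fin (n + 1) → ℝ) := by
      refine measurable_pi_lambda _ fun s => ?_
      refine Fin.cases ?_ (fun s => ?_) s
      · simp
      · simpa using measurable_pi_apply s
    simpa using hm (A.measurableSet_select t.succ)
  nonanticipating t y z h := by
    simp only [Finset.mem_filter, Finset.mem_univ, true_and]
    refine A.nonanticipating _ _ _ fun s hs => ?_
    revert hs
    refine Fin.cases (by simp) (fun s hs => ?_) s
    simpa using h s (Fin.succ_le_succ_iff.1 hs)
  card_select_le := hl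

lemma sum_mem_eq_ite_add_sum_filter_succ {n : ℕ} (S : Finset (Fin (n + 1))) (f : Fin (n + 1) → ℝ) :
    ∑ t ∈ S, f t = (if 0 ∈ S then f 0 else 0) +
      ∑ t ∈ Finset.univ.filter (fun t : Fin n => t.succ ∈ S), f t.succ := by
  have : ∑ t ∈ S, f t = ∑ t, if t ∈ S then f t else 0 := by simp
  rw [this, Fin.sum_univ_succ, Finset.sum_filter]

lemma card_eq_ite_add_card_filter_succ {n : ℕ} (S : Finset (Fin (n + 1))) :
    S.card = (if 0 ∈ S then 1 else 0) +
      (Finset.univ.filter (fun t : Fin n => t.succ ∈ S)).card := by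
  have : S.card = ∑ t, if t ∈ S then 1 else 0 := by simp
  rw [this, Fin.sum_univ_succ, Finset.card_filter]

/-- Given the first value, what remains is a policy for one period less, with budget reduced by one
if that value was selected; the Bellman equation takes the better of the two cases. -/
theorem SelectionPolicy.value_le {n k : ℕ} (A : SelectionPolicy n k) [IsProbabilityMeasure F]
    (hF : Integrable id F) : A.value F ≤ selectionValue F n k := by
  induction n generalizing k with
  | zero => simp [SelectionPolicy.value, Finset.sum_of_isEmpty]
  | succ n ih =>
    cases k with
    | zero =>
      have : ∀ x, A.select x = ∅ := fun x => by simpa using A.card_select_le x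
      simp [SelectionPolicy.value, this]
    | succ k =>
      obtain ⟨hi, he⟩ := integral_sampleLaw_succ (A.integrable hF)
      rw [SelectionPolicy.value, he, selectionValue_succ_succ hF]
      refine integral_mono hi
        ((hF.add (integrable_const _)).sup (integrable_const _)) fun x₀ => ?_
      -- The first decision cannot depend on the later values, so the zero continuation below serves
      -- as an arbitrary test point.
      have h0 : ∀ y z : Fin n → ℝ, (0 : Fin (n + 1)) ∈ A.select (Fin.cons x₀ y) ↔
          (0 : Fin (n + 1)) ∈ A.select (Fin.cons x₀ z) := fun y z =>
        A.nonanticipating 0 _ _ fun s hs => by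
          obtain rfl : s = 0 := Fin.le_zero_iff.1 hs
          simp
      have hcard : ∀ y : Fin n → ℝ, _ := fun y =>
        card_eq_ite_add_card_filter_succ (A.select (Fin.cons x₀ y))
      by_cases hs : (0 : Fin (n + 1)) ∈ A.select (Fin.cons x₀ (0 : Fin n → ℝ))
      · have hs' : ∀ y : Fin n → ℝ, (0 : Fin (n + 1)) ∈ A.select (Fin.cons x₀ y) :=
          fun y => (h0 y 0).2 hs
        have hl : ∀ y : Fin n → ℝ, (Finset.univ.filter fun t : Fin n =>
            t.succ ∈ A.select (Fin.cons x₀ y)).card ≤ k := fun y => by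
          have := hcard y
          have := A.card_select_le (Fin.cons x₀ y)
          simp only [hs', if_true] at *
          omega
        refine le_max_of_le_left ?_
        have hv := ih (A.tail x₀ k hl)
        have hint : Integrable (fun y : Fin n → ℝ => ∑ t ∈ Finset.univ.filter
            (fun t : Fin n => t.succ ∈ A.select (Fin.cons x₀ y)), y t) (sampleLaw n F) :=
          (A.tail x₀ k hl).integrable hF
        simp only [sum_mem_eq_ite_add_sum_filter_succ, hs', if_true, Fin.cons_zero, Fin.cons_succ]
        rw [integral_add (integrable_const _) hint]
        simpa [SelectionPolicy.value, SelectionPolicy.tail] using hv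
      · have hs' : ∀ y : Fin n → ℝ, (0 : Fin (n + 1)) ∉ A.select (Fin.cons x₀ y) :=
          fun y => fun h => hs ((h0 y 0).1 h)
        have hl : ∀ y : Fin n → ℝ, (Finset.univ.filter fun t : Fin n =>
            t.succ ∈ A.select (Fin.cons x₀ y)).card ≤ k + 1 := fun y => by
          have := hcard y
          have := A.card_select_le (Fin.cons x₀ y)
          simp only [hs', if_false] at *
          omega
        refine le_max_of_le_right ?_
        have hv := ih (A.tail x₀ (k + 1) hl)
        simp only [sum_mem_eq_ite_add_sum_filter_succ, hs', if_false, zero_add, Fin.cons_succ]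
        exact hv


/-! ### The optimal assignment policy -/

/-- The rank of `x` among the first `n` terms of a non-increasing sequence: the number of terms
exceeding `x`. -/
def rank (a : ℕ → ℝ) (n : ℕ) (x : ℝ) : Fin (n + 1) :=
  ⟨((Finset.range n).filter fun k => x < a k).card,
    Nat.lt_succ_of_le ((Finset.card_filter_le _ _).trans (by simp))⟩

lemma measurable_rank (a : ℕ → ℝ) (n : ℕ) : Measurable (rank a n) := by
  have hanti : Antitone fun x => (rank a n x : ℕ) := fun x y hxy => by
    simp only [rank]
    refine Finset.card_le_card fun k hk => ?_
    simp only [Finset.mem_filter] at hk ⊢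
    exact ⟨hk.1, hxy.trans_lt hk.2⟩
  refine measurable_to_countable' fun i => ?_
  have := hanti.measurable (measurableSet_singleton (i : ℕ))
  convert this using 1
  ext x
  simp [Fin.ext_iff]

/-- For non-increasing a, the terms exceeding x form an initial segment. -/
lemma lt_rank_iff {a : ℕ → ℝ} (ha : Antitone a) {n k : ℕ} (hk : k < n) (x : ℝ) :
    k < (rank a n x : ℕ) ↔ x < a k := by
  simp only [rank]
  constructor
  · intro h
    by_contra! hx
    have : (Finset.range n).filter (fun j => x < a j) ⊆ Finset.range k := fun j hj => by
      simp only [Finset.mem_filter, Finset.mem_range] at hj ⊢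
      by_contra! hkj
      exact absurd (hj.2.trans_le (ha hkj)) (not_lt.2 hx)
    have := Finset.card_le_card this
    simp only [Finset.card_range] at this
    omega
  · intro h
    have : Finset.range (k + 1) ⊆ (Finset.range n).filter (fun j => x < a j) := fun j hj => by
      simp only [Finset.mem_filter, Finset.mem_range] at hj ⊢
      exact ⟨by omega, h.trans_le (ha (by omega))⟩
    have := Finset.card_le_card this
    simp only [Finset.card_range] at this
    omega

/-- The rank is the position where x lands. Since it counts only the first n terms, a n ≤ x is
needed: otherwise a n could occupy position n. -/
lemma insertDesc_rank {a : ℕ → ℝ} (ha : Antitone a) {n : ℕ} {x : ℝ} (hx : a n ≤ x) :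
    insertDesc x a (rank a n x) = x := by
  have h2 : a (rank a n x) ≤ x := by
    by_contra! h
    by_cases hr : (rank a n x : ℕ) < n
    · exact lt_irrefl _ ((lt_rank_iff ha hr x).2 h)
    · exact absurd (h.trans_le (ha (not_lt.1 hr))) (not_lt.2 hx)
  rcases hq : (rank a n x : ℕ) with _ | q
  · rw [hq] at h2
    simp [insertDesc, h2]
  · rw [hq] at h2
    have hqn : q < n := by have := (rank a n x).2; omega
    have h1 : x < a q := (lt_rank_iff ha hqn x).1 (by omega)
    simp [insertDesc, h2, h1.le]

lemma insertDesc_succAbove_rank {a : ℕ → ℝ} (ha : Antitone a) {n : ℕ} (x : ℝ) (i : Fin n) :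
    insertDesc x a ((rank a n x).succAbove i) = a i := by
  by_cases h : (i : ℕ) < rank a n x
  · rw [Fin.succAbove_of_castSucc_lt _ _ (by simpa [Fin.lt_def] using h)]
    have h1 := (lt_rank_iff ha i.2 x).1 h
    rcases hi : (i : ℕ) with _ | j
    · simp only [Fin.val_castSucc, hi, insertDesc]
      rw [hi] at h1
      exact max_eq_right h1.le
    · simp only [Fin.val_castSucc, hi, insertDesc]
      rw [hi] at h1
      exact max_eq_right ((min_le_left _ _).trans h1.le)
  · rw [Fin.succAbove_of_le_castSucc _ _ (by simpa [Fin.le_def] using h)]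
    have h1 := not_lt.1 (mt (lt_rank_iff ha i.2 x).2 h)
    simp only [Fin.val_succ, insertDesc, min_eq_right h1]
    exact max_eq_left (ha (Nat.le_succ _))

/-- One step of the assignment recursion: x takes the weight at its rank, and the other weights, in
unchanged order, meet the old sequence. -/
lemma sum_mul_insertDesc {a : ℕ → ℝ} (ha : Antitone a) {n : ℕ} {x : ℝ} (hx : a n ≤ x)
    (s : Fin (n + 1) → ℝ) :
    ∑ i, s i * insertDesc x a i =
      x * s (rank a n x) + ∑ i, s ((rank a n x).succAbove i) * a i := by
  rw [Fin.sum_univ_succAbove _ (rank a n x), insertDesc_rank ha hx, mul_comm]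
  simp only [insertDesc_succAbove_rank ha]

/-- The permutation sending `0` to `p` and acting as `σ` between the remaining indices. -/
def consPerm {n : ℕ} (p : Fin (n + 1)) (σ : Equiv.Perm (Fin n)) : Equiv.Perm (Fin (n + 1)) :=
  ((finSuccEquiv' 0).trans (Equiv.optionCongr σ)).trans (finSuccEquiv' p).symm

@[simp] lemma consPerm_zero {n : ℕ} (p : Fin (n + 1)) (σ : Equiv.Perm (Fin n)) :
    consPerm p σ 0 = p := by
  simp [consPerm]

@[simp] lemma consPerm_succ {n : ℕ} (p : Fin (n + 1)) (σ : Equiv.Perm (Fin n)) (t : Fin n) :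
    consPerm p σ t.succ = p.succAbove (σ t) := by
  have : finSuccEquiv' (0 : Fin (n + 1)) t.succ = some t := by
    rw [← Fin.zero_succAbove]; exact finSuccEquiv'_succAbove _ _
  simp [consPerm, this]

/-- The optimal policy for rewards in non-increasing order: the first value receives the reward
whose rank is the rank of the value among the marginal values of the next period. -/
def rankPolicy (F : Measure ℝ) : (n : ℕ) → AssignmentPolicy n
  | 0 =>
    { assign := fun _ => 1
      measurableSet_assign := fun t => t.elim0
      nonanticipating := fun t => t.elim0 }
  | n + 1 =>
    { assign := fun x =>
        consPerm (rank (marginal F n) n (x 0)) ((rankPolicy F n).assign (Fin.tail x))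
      measurableSet_assign := fun t i => by
        have h0 : Measurable fun x : Fin (n + 1) → ℝ => rank (marginal F n) n (x 0) :=
          (measurable_rank _ _).comp (measurable_pi_apply 0)
        refine Fin.cases ?_ (fun t => ?_) t
        · simp only [consPerm_zero]
          exact h0 (measurableSet_singleton i)
        · have h1 : Measurable fun x : Fin (n + 1) → ℝ => (rankPolicy F n).assign (Fin.tail x) t :=
            (measurable_to_countable' fun j => (rankPolicy F n).measurableSet_assign t j).comp
              (measurable_pi_lambda _ fun s => measurable_pi_apply s.succ)
          have h2 : Measurable fun q : Fin (n + 1) × Fin n => q.1.succAbove q.2 :=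
            measurable_of_countable _
          simpa [Set.preimage] using (h2.comp (h0.prodMk h1)) (measurableSet_singleton i)
      nonanticipating := fun t x y => by
        refine Fin.cases (fun h => ?_) (fun t h => ?_) t
        · simp [h 0 le_rfl]
        · have := (rankPolicy F n).nonanticipating t (Fin.tail x) (Fin.tail y)
            fun s hs => h s.succ (Fin.succ_le_succ_iff.2 hs)
          simp [h 0 (Fin.zero_le _), this] }

lemma AssignmentPolicy.integrable {n : ℕ} (π : AssignmentPolicy n) [IsProbabilityMeasure F]
    (hF : Integrable id F) (r : Fin n → ℝ) :
    Integrable (fun x => ∑ t, x t * r (π.assign x t)) (sampleLaw n F) := by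
  have : (fun x : Fin n → ℝ => ∑ t, x t * r (π.assign x t)) =
      fun x => ∑ t, ∑ i, {x | π.assign x t = i}.indicator (fun x => x t * r i) x := by
    ext x
    simp [Set.indicator_apply]
  rw [this]
  exact integrable_finsetSum _ fun t _ => integrable_finsetSum _ fun i _ =>
    ((integrable_eval_sampleLaw hF t).mul_const _).indicator (π.measurableSet_assign t i)

/-- After the first assignment the same policy faces the remaining rewards, so the induction must
cover all s; no ordering of s is needed. -/
theorem rankPolicy_value (hF : IsValueDist F) {n : ℕ} (s : Fin n → ℝ) :
    (rankPolicy F n).value F s = ∑ i, s i * marginal F n i := by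
  have := hF.isProbability
  induction n with
  | zero => simp [AssignmentPolicy.value]
  | succ n ih =>
    rw [AssignmentPolicy.value,
      (integral_sampleLaw_succ ((rankPolicy F (n + 1)).integrable hF.finite_mean s)).2]
    simp only [marginal, ← integral_const_mul]
    rw [← integral_finsetSum _ fun (i : Fin (n + 1)) _ =>
      (integrable_insertDesc hF.finite_mean (marginal F n) i).const_mul (s i)]
    refine integral_congr_ae ?_
    filter_upwards [hF.ae_nonneg] with x hx
    rw [sum_mul_insertDesc (antitone_marginal hF.finite_mean n)
      -- With n periods left rank n has marginal value 0, so the condition on x is just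
      -- non-negativity.
      (by rwa [hF.marginal_eq_zero le_rfl]), ← ih]
    simp only [Fin.sum_univ_succ, rankPolicy, Fin.cons_zero, consPerm_zero, Fin.cons_succ,
      consPerm_succ, Fin.tail_cons]
    rw [integral_add (integrable_const _) ((rankPolicy F n).integrable hF.finite_mean
      fun j => s ((rank (marginal F n) n x).succAbove j))]
    simp [AssignmentPolicy.value]

/-- The policy that uses the rewards in reversed order. -/
def AssignmentPolicy.reverse {n : ℕ} (π : AssignmentPolicy n) : AssignmentPolicy n where
  assign x := (π.assign x).trans Fin.revPerm
  measurableSet_assign t i := by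
    simpa [Fin.rev_eq_iff] using π.measurableSet_assign t i.rev
  nonanticipating t x y h := by
    simp [π.nonanticipating t x y h]

lemma AssignmentPolicy.value_reverse {n : ℕ} (π : AssignmentPolicy n) (r : Fin n → ℝ) :
    π.reverse.value F r = π.value F fun i => r i.rev := rfl

/-! ### Order statistics -/

/-- Counting removes the sorting permutation, which itself varies with x; monotonicity and
measurability then follow. -/
lemma orderStat_le_iff {n : ℕ} (x : Fin n → ℝ) (i : Fin n) (a : ℝ) :
    orderStat x i ≤ a ↔ (i : ℕ) < (Finset.univ.filter fun t => x t ≤ a).card := by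
  rw [← Finset.card_equiv (s := Finset.univ.filter fun t => x (Tuple.sort x t) ≤ a)
    (Tuple.sort x) (by simp)]
  exact (Tuple.lt_card_le_iff_apply_le_of_monotone (Tuple.monotone_sort x)).symm

lemma orderStat_mono {n : ℕ} {x y : Fin n → ℝ} (h : x ≤ y) (i : Fin n) :
    orderStat x i ≤ orderStat y i := by
  rw [orderStat_le_iff]
  refine ((orderStat_le_iff y i _).1 le_rfl).trans_le (Finset.card_le_card fun t ht => ?_)
  simp only [Finset.mem_filter, Finset.mem_univ, true_and] at ht ⊢
  exact (h t).trans ht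

lemma measurable_orderStat {n : ℕ} (i : Fin n) :
    Measurable fun x : Fin n → ℝ => orderStat x i := by
  refine measurable_of_Iic fun a => ?_
  have hm : Measurable fun x : Fin n → ℝ => (Finset.univ.filter fun t => x t ≤ a).card := by
    simp only [Finset.card_filter]
    exact Finset.measurable_sum _ fun t _ => Measurable.ite
      (measurableSet_le (measurable_pi_apply t) measurable_const) measurable_const measurable_const
  simpa [Set.preimage, orderStat_le_iff] using hm (measurableSet_Ioi (a := (i : ℕ)))

lemma integrable_orderStat [IsProbabilityMeasure F] (hF : Integrable id F) {n : ℕ} (i : Fin n) :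
    Integrable (fun x => orderStat x i) (sampleLaw n F) := by
  refine Integrable.mono' (integrable_finsetSum Finset.univ fun t _ =>
    (integrable_eval_sampleLaw hF t).norm) (measurable_orderStat i).aestronglyMeasurable
    (.of_forall fun x => ?_)
  exact Finset.single_le_sum (f := fun t => ‖x t‖) (fun t _ => norm_nonneg _)
    (Finset.mem_univ (Tuple.sort x i))

lemma IsValueDist.integral_orderStat_nonneg (h : IsValueDist F) {n : ℕ} (i : Fin n) :
    0 ≤ ∫ x, orderStat x i ∂sampleLaw n F := by
  have := h.isProbability
  refine integral_nonneg_of_ae ?_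
  have : ∀ᵐ x ∂sampleLaw n F, ∀ t, 0 ≤ x t := ae_all_iff.2 fun t =>
    (measurePreserving_eval (fun _ : Fin n => F) t).quasiMeasurePreserving.ae h.ae_nonneg
  filter_upwards [this] with x hx using hx _

lemma selectionOpt_eq_sum [IsProbabilityMeasure F] (hF : Integrable id F) (n k : ℕ) :
    selectionOpt n k F =
      ∑ i ∈ Finset.univ.filter (fun i : Fin n => n ≤ (i : ℕ) + k),
        ∫ x, orderStat x i ∂sampleLaw n F :=
  integral_finsetSum _ fun i _ => integrable_orderStat hF i

lemma IsValueDist.selectionOpt_nonneg (h : IsValueDist F) (n k : ℕ) : 0 ≤ selectionOpt n k F := by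
  have := h.isProbability
  rw [selectionOpt_eq_sum h.finite_mean]
  exact Finset.sum_nonneg fun i _ => h.integral_orderStat_nonneg i

lemma assignmentOpt_one [IsProbabilityMeasure F] (hF : Integrable id F) (n : ℕ) :
    assignmentOpt n F (fun _ => 1) = ∫ x, ∑ t, x t ∂sampleLaw n F := by
  simp only [assignmentOpt, one_mul]
  rw [← integral_finsetSum _ fun i _ => integrable_orderStat hF i]
  refine integral_congr_ae (.of_forall fun x => ?_)
  exact Equiv.sum_comp (Tuple.sort x) x


/-! ### Smoothing of a distribution -/

/-- The uniform distribution on `[0, 1]`. -/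
def unitUniform : Measure ℝ := volume.restrict (Set.Icc 0 1)

instance : IsProbabilityMeasure unitUniform := ⟨by simp [unitUniform]⟩

/-- The law of `X + ε U`, where `X` has law `F` and `U` is independent and uniform on `[0, 1]`. -/
def smooth (F : Measure ℝ) (ε : ℝ) : Measure ℝ :=
  (F.prod unitUniform).map fun p => p.1 + ε * p.2

lemma measurable_smooth (ε : ℝ) : Measurable fun p : ℝ × ℝ => p.1 + ε * p.2 := by fun_prop

instance [IsProbabilityMeasure F] (ε : ℝ) : IsProbabilityMeasure (smooth F ε) :=
  Measure.isProbabilityMeasure_map (measurable_smooth ε).aemeasurable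

lemma ae_unitUniform [IsProbabilityMeasure F] :
    ∀ᵐ p ∂F.prod unitUniform, p.2 ∈ Set.Icc (0 : ℝ) 1 :=
  Measure.quasiMeasurePreserving_snd.ae (ae_restrict_mem measurableSet_Icc)

lemma integrable_smooth [IsProbabilityMeasure F] (hF : Integrable id F) (ε : ℝ) :
    Integrable id (smooth F ε) := by
  have hU : Integrable id unitUniform := continuous_id.integrableOn_Icc
  rw [smooth, integrable_map_measure aestronglyMeasurable_id (measurable_smooth ε).aemeasurable]
  exact (hF.comp_fst unitUniform).add ((hU.comp_snd F).const_mul ε)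

lemma IsValueDist.smooth (h : IsValueDist F) {ε : ℝ} (hε : 0 ≤ ε) :
    IsValueDist (smooth F ε) := by
  have := h.isProbability
  refine ⟨inferInstance, ?_, integrable_smooth h.finite_mean ε⟩
  have h1 : ∀ᵐ p ∂F.prod unitUniform, (0 : ℝ) ≤ p.1 :=
    Measure.quasiMeasurePreserving_fst.ae h.ae_nonneg
  rw [SSAP.smooth, Measure.map_apply (measurable_smooth ε) measurableSet_Iio]
  have : ∀ᵐ p ∂F.prod unitUniform, ¬ p.1 + ε * p.2 < 0 := by
    filter_upwards [h1, ae_unitUniform] with p hp hu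
    exact not_lt.2 (add_nonneg hp (mul_nonneg hε hu.1))
  simp only [ae_iff, not_not] at this
  exact this

/-- For each fixed x, at most one u satisfies x + εu = c. -/
lemma nullSingletonClass_smooth [IsProbabilityMeasure F] {ε : ℝ} (hε : 0 < ε) :
    NullSingletonClass (smooth F ε) := by
  refine ⟨fun c => ?_⟩
  rw [smooth, Measure.map_apply (measurable_smooth ε) (measurableSet_singleton c),
    Measure.measure_prod_null (measurable_smooth ε (measurableSet_singleton c))]
  refine .of_forall fun x => ?_
  have : Prod.mk x ⁻¹' ((fun p : ℝ × ℝ => p.1 + ε * p.2) ⁻¹' {c}) ⊆ {(c - x) / ε} := fun u hu => by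
    simp only [Set.mem_preimage, Set.mem_singleton_iff] at hu ⊢
    rw [eq_div_iff hε.ne']
    linarith
  refine measure_mono_null this ?_
  exact Measure.absolutelyContinuous_of_le Measure.restrict_le_self (by simp)

/-- Each of at most k selected values grows by at most ε; the Bellman equation propagates this
bound. -/
lemma selectionValue_smooth_le [IsProbabilityMeasure F] (hF : Integrable id F) {ε : ℝ}
    (hε : 0 ≤ ε) (n k : ℕ) :
    selectionValue (smooth F ε) n k ≤ selectionValue F n k + k * ε := by
  induction n generalizing k with
  | zero => simpa using mul_nonneg k.cast_nonneg hε
  | succ n ih =>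
    cases k with
    | zero => simp
    | succ k =>
      have hint : ∀ b d : ℝ, Integrable (fun x => max (x + b) d) F := fun b d =>
        (hF.add (integrable_const _)).sup (integrable_const _)
      have hint' : ∀ b d : ℝ, Integrable (fun x => max (x + b) d) (smooth F ε) := fun b d =>
        ((integrable_smooth hF ε).add (integrable_const _)).sup (integrable_const _)
      rw [selectionValue_succ_succ (integrable_smooth hF ε), selectionValue_succ_succ hF]
      set b := selectionValue F n k
      set d := selectionValue F n (k + 1)
      have hR : ∫ x, max (x + b) d ∂F + ((k + 1 : ℕ) : ℝ) * ε =
          ∫ p, (max (p.1 + b) d + ((k + 1 : ℕ) : ℝ) * ε) ∂F.prod unitUniform := by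
        rw [integral_add ((hint b d).comp_fst unitUniform) (integrable_const _),
          integral_fun_fst fun x => max (x + b) d]
        simp
      rw [hR]
      have hL := hint' (selectionValue (smooth F ε) n k) (selectionValue (smooth F ε) n (k + 1))
      rw [smooth, integrable_map_measure
        (by fun_prop) (measurable_smooth ε).aemeasurable] at hL
      conv_lhs => arg 1; rw [smooth]
      rw [integral_map (measurable_smooth ε).aemeasurable (by fun_prop)]
      refine integral_mono_ae hL
        (((hint b d).comp_fst unitUniform).add (integrable_const _)) ?_
      filter_upwards [ae_unitUniform] with p hp
      have h1 := ih k
      have h2 := ih (k + 1)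
      have h3 : ε * p.2 ≤ ε := mul_le_of_le_one_right hε hp.2
      have h4 := le_max_left (p.1 + b) d
      have h5 := le_max_right (p.1 + b) d
      push_cast at h2 ⊢
      exact max_le (by linarith) (by linarith)

/-- Coupling: both samples are images of one sample of pairs (X, U), on which the smoothed values
dominate. -/
lemma integral_orderStat_le_smooth [IsProbabilityMeasure F] (hF : Integrable id F) {ε : ℝ}
    (hε : 0 ≤ ε) {n : ℕ} (i : Fin n) :
    ∫ x, orderStat x i ∂sampleLaw n F ≤ ∫ x, orderStat x i ∂sampleLaw n (smooth F ε) := by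
  have h1 : sampleLaw n F = (Measure.pi fun _ : Fin n => F.prod unitUniform).map
      fun ω t => (ω t).1 := by
    rw [Measure.pi_map_pi (f := fun _ => Prod.fst) fun _ => measurable_fst.aemeasurable]
    simp [sampleLaw]
  have h2 : sampleLaw n (smooth F ε) = (Measure.pi fun _ : Fin n => F.prod unitUniform).map
      fun ω t => (ω t).1 + ε * (ω t).2 := by
    have : IsProbabilityMeasure ((F.prod unitUniform).map fun p => p.1 + ε * p.2) :=
      Measure.isProbabilityMeasure_map (measurable_smooth ε).aemeasurable
    exact (Measure.pi_map_pi (f := fun _ (p : ℝ × ℝ) => p.1 + ε * p.2)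
      fun _ => (measurable_smooth ε).aemeasurable).symm
  have m1 : Measurable fun (ω : Fin n → ℝ × ℝ) t => (ω t).1 := by fun_prop
  have m2 : Measurable fun (ω : Fin n → ℝ × ℝ) t => (ω t).1 + ε * (ω t).2 := by fun_prop
  have i1 := integrable_orderStat hF i
  have i2 := integrable_orderStat (integrable_smooth hF ε) i
  have hm := fun μ : Measure (Fin n → ℝ) => (measurable_orderStat i).aestronglyMeasurable (μ := μ)
  rw [h1, integrable_map_measure (hm _) m1.aemeasurable] at i1
  rw [h2, integrable_map_measure (hm _) m2.aemeasurable] at i2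
  rw [h1, h2, integral_map m1.aemeasurable (hm _), integral_map m2.aemeasurable (hm _)]
  refine integral_mono_ae i1 i2 ?_
  have hu : ∀ᵐ ω ∂(Measure.pi fun _ : Fin n => F.prod unitUniform),
      ∀ t, (ω t).2 ∈ Set.Icc (0 : ℝ) 1 := ae_all_iff.2 fun t =>
    (measurePreserving_eval (fun _ : Fin n => F.prod unitUniform) t).quasiMeasurePreserving.ae
      ae_unitUniform
  filter_upwards [hu] with ω hω
  exact orderStat_mono (fun t => le_add_of_nonneg_right (mul_nonneg hε (hω t).1)) i

lemma selectionOpt_le_smooth [IsProbabilityMeasure F] (hF : Integrable id F) {ε : ℝ}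
    (hε : 0 ≤ ε) (n k : ℕ) : selectionOpt n k F ≤ selectionOpt n k (smooth F ε) := by
  rw [selectionOpt_eq_sum hF, selectionOpt_eq_sum (integrable_smooth hF ε)]
  exact Finset.sum_le_sum fun i _ => integral_orderStat_le_smooth hF hε i

/-! ### Comparison of the ratios -/

theorem IsSelectionRatio.mul_selectionOpt_le {n k : ℕ} {c : ℝ} (hc : 0 ≤ c)
    (h : IsSelectionRatio n k c) (hF : IsValueDist F) :
    c * selectionOpt n k F ≤ selectionValue F n k := by
  have := hF.isProbability
  obtain ⟨alg, halg⟩ := h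
  have key : ∀ ε : ℝ, 0 < ε → c * selectionOpt n k F ≤ selectionValue F n k + k * ε := by
    intro ε hε
    calc c * selectionOpt n k F ≤ c * selectionOpt n k (smooth F ε) :=
          mul_le_mul_of_nonneg_left (selectionOpt_le_smooth hF.finite_mean hε.le n k) hc
      _ ≤ (alg (smooth F ε)).value (smooth F ε) :=
          halg _ (hF.smooth hε.le) (nullSingletonClass_smooth hε)
      _ ≤ selectionValue (smooth F ε) n k :=
          SelectionPolicy.value_le _ (integrable_smooth hF.finite_mean ε)
      _ ≤ _ := selectionValue_smooth_le hF.finite_mean hε.le n k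
  -- The denominator k + 1 rather than k also covers k = 0.
  refine le_of_forall_pos_le_add fun δ hδ => (key (δ / (k + 1)) (by positivity)).trans ?_
  have : (k : ℝ) * (δ / (k + 1)) ≤ δ := by
    rw [mul_div_assoc', div_le_iff₀ (by positivity)]
    nlinarith
  linarith

lemma IsSelectionRatio.mono {n k : ℕ} {c c' : ℝ} (h : IsSelectionRatio n k c') (hc : c ≤ c') :
    IsSelectionRatio n k c := by
  obtain ⟨alg, halg⟩ := h
  exact ⟨alg, fun F hF hF' =>
    (mul_le_mul_of_nonneg_right hc (hF.selectionOpt_nonneg n k)).trans (halg F hF hF')⟩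

lemma isSelectionRatio_zero (n k : ℕ) : IsSelectionRatio n k 0 :=
  ⟨fun _ => ⟨fun _ => ∅, by simp, by simp, by simp⟩, by simp [SelectionPolicy.value]⟩

/-- The ratios form a downward closed, nonempty set; no upper bound on them is needed. -/
lemma isSelectionRatio_of_lt_gamma {n k : ℕ} {c : ℝ} (h : c < gamma n k) :
    IsSelectionRatio n k c := by
  obtain ⟨c', hc', hlt⟩ := exists_lt_of_lt_csSup ⟨0, isSelectionRatio_zero n k⟩ h
  exact IsSelectionRatio.mono hc' hlt.le

/-- Summation by parts: a non-increasing non-negative weighting of a sequence with non-negative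
partial sums has a non-negative sum. -/
lemma sum_mul_nonneg_of_partial_sums_nonneg {n : ℕ} {s u : ℕ → ℝ} (hs : AntitoneOn s (Set.Iio n))
    (hs0 : ∀ k < n, 0 ≤ s k) (hu : ∀ k ≤ n, 0 ≤ ∑ i ∈ Finset.range k, u i) :
    0 ≤ ∑ i ∈ Finset.range n, s i * u i := by
  -- Strengthened for induction: the last weight times the last partial sum is a lower bound.
  have key : ∀ m < n, s m * ∑ i ∈ Finset.range (m + 1), u i ≤
      ∑ i ∈ Finset.range (m + 1), s i * u i := by
    intro m hm
    induction m with
    | zero => simp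
    | succ m ih =>
      rw [Finset.sum_range_succ, Finset.sum_range_succ _ (m + 1), mul_add]
      have h1 : s (m + 1) ≤ s m :=
        hs (Set.mem_Iio.2 (by omega)) (Set.mem_Iio.2 hm) (Nat.le_succ m)
      have h2 := mul_le_mul_of_nonneg_right h1 (hu (m + 1) (by omega))
      linarith [ih (by omega)]
  cases n with
  | zero => simp
  | succ m =>
    exact (mul_nonneg (hs0 m (by omega)) (hu _ le_rfl)).trans (key m (by omega))

theorem mul_assignmentOpt_le {n : ℕ} {c : ℝ} (hF : IsValueDist F)
    (hc : ∀ k ∈ Finset.Icc 1 n, c * selectionOpt n k F ≤ selectionValue F n k)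
    {r : Fin n → ℝ} (hr : Monotone r) (hr0 : ∀ i, 0 ≤ r i) :
    c * assignmentOpt n F r ≤ (rankPolicy F n).reverse.value F r := by
  have := hF.isProbability
  rw [AssignmentPolicy.value_reverse, rankPolicy_value hF]
  -- Rewards and expected order statistics are listed from the largest down; the default 0 beyond n
  -- is never used.
  let s : ℕ → ℝ := fun k => if h : k < n then r (Fin.rev ⟨k, h⟩) else 0
  let o : ℕ → ℝ := fun k =>
    if h : k < n then ∫ x, orderStat x (Fin.rev ⟨k, h⟩) ∂sampleLaw n F else 0
  have hs : ∀ i : Fin n, s i = r i.rev := fun i => by simp [s]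
  have ho : ∀ i : Fin n, o i = ∫ x, orderStat x i.rev ∂sampleLaw n F := fun i => by simp [o]
  have hopt : ∀ k ≤ n, selectionOpt n k F = ∑ i ∈ Finset.range k, o i := by
    intro k hk
    rw [selectionOpt_eq_sum hF.finite_mean, Finset.sum_filter, ← Equiv.sum_comp Fin.revPerm]
    simp only [Fin.revPerm_apply, ← ho]
    have : ∀ i : Fin n, n ≤ (i.rev : ℕ) + k ↔ (i : ℕ) < k := fun i => by
      rw [Fin.val_rev]; omega
    simp only [this]
    rw [Fin.sum_univ_eq_sum_range (fun i => if i < k then o i else 0) n, ← Finset.sum_filter]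
    congr 1
    ext i
    simp only [Finset.mem_filter, Finset.mem_range]
    omega
  have hass : assignmentOpt n F r = ∑ i ∈ Finset.range n, s i * o i := by
    rw [assignmentOpt, ← Equiv.sum_comp Fin.revPerm,
      ← Fin.sum_univ_eq_sum_range (fun i => s i * o i) n]
    simp only [Fin.revPerm_apply, hs, ho]
  have hval : ∑ i : Fin n, r i.rev * marginal F n i =
      ∑ i ∈ Finset.range n, s i * marginal F n i := by
    rw [← Fin.sum_univ_eq_sum_range (fun i => s i * marginal F n i) n]
    simp only [hs]
  rw [hass, hval, ← sub_nonneg]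
  have hmain : 0 ≤ ∑ i ∈ Finset.range n, s i * (marginal F n i - c * o i) := by
    refine sum_mul_nonneg_of_partial_sums_nonneg ?_ ?_ fun k hk => ?_
    · intro i hi j hj hij
      simp only [Set.mem_Iio] at hi hj
      simp only [s, hi, hj, dif_pos]
      exact hr (Fin.rev_le_rev.2 hij)
    · intro k hk
      simp only [s, hk, dif_pos]
      exact hr0 _
    · rcases Nat.eq_zero_or_pos k with rfl | hk0
      · simp
      · rw [Finset.sum_sub_distrib, ← Finset.mul_sum, ← hopt k hk, sub_nonneg]
        exact hc k (Finset.mem_Icc.2 ⟨hk0, hk⟩)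
  simpa only [mul_sub, Finset.sum_sub_distrib, mul_left_comm, Finset.mul_sum] using hmain

lemma isValueDist_dirac_one : IsValueDist (Measure.dirac 1) :=
  ⟨inferInstance, by simp, integrable_dirac (by simp)⟩

/-- With all values and rewards equal to 1, every policy earns exactly the optimum n > 0. This bound
is what makes the supremum in `alpha` meaningful. -/
lemma IsAssignmentRatio.le_one {n : ℕ} (hn : 1 ≤ n) {c : ℝ} (h : IsAssignmentRatio n c) :
    c ≤ 1 := by
  obtain ⟨alg, halg⟩ := h
  have := halg (Measure.dirac 1) (fun _ => 1) isValueDist_dirac_one monotone_const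
    fun _ => zero_le_one
  rw [assignmentOpt_one isValueDist_dirac_one.finite_mean, AssignmentPolicy.value] at this
  simp only [mul_one] at this
  have hM : ∫ x : Fin n → ℝ, ∑ t, x t ∂sampleLaw n (Measure.dirac 1) = n := by
    rw [integral_finsetSum _ fun t _ =>
      integrable_eval_sampleLaw isValueDist_dirac_one.finite_mean t]
    have : ∀ t : Fin n, ∫ x : Fin n → ℝ, x t ∂sampleLaw n (Measure.dirac 1) = 1 := fun t => by
      exact (integral_comp_eval (μ := fun _ : Fin n => Measure.dirac (1 : ℝ))
        (f := id) aestronglyMeasurable_id).trans (by simp)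
    simp [this]
  rw [hM] at this
  exact le_of_mul_le_mul_right (by simpa using this) (by exact_mod_cast hn)

end SSAP

end

theorem mainTheorem4 (n : ℕ) (hn : 1 ≤ n) :
    (Finset.Icc 1 n).inf' (Finset.nonempty_Icc.mpr hn) (fun k => SSAP.gamma n k) ≤
      SSAP.alpha n := by
  have hbdd : BddAbove {c : ℝ | SSAP.IsAssignmentRatio n c} := ⟨1, fun _ hc => hc.le_one hn⟩
  have hratio : ∀ c : ℝ, (∀ F, SSAP.IsValueDist F → ∀ k ∈ Finset.Icc 1 n,
      c * SSAP.selectionOpt n k F ≤ SSAP.selectionValue F n k) → c ≤ SSAP.alpha n := fun c hc =>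
    le_csSup hbdd ⟨fun F _ => (SSAP.rankPolicy F n).reverse, fun F _ hF hr hr0 =>
      SSAP.mul_assignmentOpt_le hF (hc F hF) hr hr0⟩
  -- The transfer through smoothing requires c ≥ 0, so negative c are settled by the trivial ratio
  -- 0.
  have h0 : 0 ≤ SSAP.alpha n := hratio 0 fun F hF k _ =>
    (SSAP.isSelectionRatio_zero n k).mul_selectionOpt_le le_rfl hF
  refine le_of_forall_lt_imp_le_of_dense fun c hc => ?_
  rcases lt_or_ge c 0 with hneg | hpos
  · exact hneg.le.trans h0
  · refine hratio c fun F hF k hk => ?_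
    exact (SSAP.isSelectionRatio_of_lt_gamma
      ((Finset.lt_inf'_iff _).1 hc k hk)).mul_selectionOpt_le hpos hF
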